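/- Let $s\in L^2([0,1]^2)$ be a real-valued kernel with $s\ge 0$ almost everywhere, and for $g\in L^2([0,1];\mathbb{C})$ put $$(Sg)(x)=\int_0^1 s(x,y)\,g(y)\,dy .$$ Let $\mathbb{C}^+=\{z\in\mathbb{C}:\operatorname{Im} z>0\}$. Then for every $z\in\mathbb{C}^+$ there is exactly one $g_z\in L^2([0,1];\mathbb{C})$ (functions that agree almost everywhere being identified) such that, for almost every $x\in[0,1]$, $g_z(x)\in\mathbb{C}^+$ and $$g_z(x)=-\frac{1}{z+(Sg_z)(x)} .$$ Moreover, the map $z\mapsto g_z$ from $\mathbb{C}^+$ to $L^2([0,1];\mathbb{C})$ is holomorphic with respect to the $L^2$ norm. -/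

import Mathlib

open MeasureTheory

noncomputable section

/-- The integral operator `(S g)(x) = ∫₀¹ s(x, y) g(y) dy` with kernel `s` on `[0,1]²`, where `[0,1]`
(the type `unitInterval`) carries Lebesgue measure. If `s` is in `L²([0,1]²)` and `g` is in
`L²([0,1])`, the integrand is integrable for almost every `x`. -/
def kernelOp (s : unitInterval × unitInterval → ℝ) (g : unitInterval → ℂ) (x : unitInterval) : ℂ :=
  ∫ y : unitInterval, (s (x, y) : ℂ) * g y

/-- `g`, an element of complex `L²([0,1])`, takes values in the open upper half-plane and satisfies
`g = -1 / (z + S g)`. As for all statements on elements of `L²`, both hold almost everywhere. -/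
structure IsQVESolution (s : unitInterval × unitInterval → ℝ) (z : ℂ)
    (g : Lp ℂ 2 (volume : Measure unitInterval)) : Prop where
  im_pos : ∀ᵐ x : unitInterval, 0 < (g x).im
  eqn : ∀ᵐ x : unitInterval, g x = -1 / (z + kernelOp s g x)

end

/-! For `Im z > 0` the solutions are the fixed points of `Φ_z(g) = -1 / (z + S g)` among the `g`
with `Im (S g) ≥ 0`. There `Φ_z` has Lipschitz constant at most `C / (Im z)^2`, which yields a
contraction only far from the real axis (`exists_norm_iterate_sub_le`). Closer to the axis,
holomorphy takes over. From a fixed start the iterates are holomorphic in `z`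
(`differentiableAt_iterate_resolventMap`) and, after one step, bounded by `1 / Im z`. A difference
of two iterates that is small high up is therefore small on a disc reaching down to any given point
(`exists_small_of_small_on_subdisc`, `exists_disc_upperHalfPlane`). Hence the iterates of 0 converge
locally uniformly, which gives existence and holomorphy. Iterating from a solution at `z₀`, kept
fixed as `z` varies, gives uniqueness. -/

open Filter Topology Metric

/-! ### Propagation of smallness for bounded holomorphic functions. -/

/-- The terms of the Taylor series of a function on `ball c R` that is bounded by `M`. -/
theorem norm_taylor_term_le {E : Type*} [NormedAddCommGroup E] [NormedSpace ℂ E]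
    [CompleteSpace E] {f : ℂ → E} {c z : ℂ} {R r M : ℝ} (hR : 0 < R) (hf : DiffContOnCl ℂ f (ball c R))
    (hM : ∀ w ∈ closedBall c R, ‖f w‖ ≤ M) (hz : z ∈ closedBall c r) (k : ℕ) :
    ‖(k.factorial : ℂ)⁻¹ • (z - c) ^ k • iteratedDeriv k f c‖ ≤ M * (r / R) ^ k := by
  have h := Complex.norm_iteratedDeriv_le_of_forall_mem_sphere_norm_le k hR hf
    fun w hw => hM w (sphere_subset_closedBall hw)
  have hzr : ‖z - c‖ ≤ r := by simpa [dist_eq_norm] using hz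
  have hM0 : 0 ≤ M := (norm_nonneg _).trans (hM c (mem_closedBall_self hR.le))
  have hr : 0 ≤ r := (norm_nonneg _).trans hzr
  have hk : (0 : ℝ) < k.factorial := by exact_mod_cast k.factorial_pos
  rw [norm_smul, norm_smul, norm_inv, norm_pow, Complex.norm_natCast]
  calc (k.factorial : ℝ)⁻¹ * (‖z - c‖ ^ k * ‖iteratedDeriv k f c‖)
      ≤ (k.factorial : ℝ)⁻¹ * (r ^ k * (k.factorial * M / R ^ k)) := by gcongr
    _ = M * (r / R) ^ k := by rw [div_pow]; field_simp

/-- A quantitative form of Vitali's theorem on discs: a bounded holomorphic function on a disc that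
is small on a smaller concentric disc is small on every compact subdisc. -/
theorem exists_small_of_small_on_subdisc {E : Type*} [NormedAddCommGroup E] [NormedSpace ℂ E]
    [CompleteSpace E] {R r ρ M : ℝ} (hρ : 0 < ρ) (hρR : ρ ≤ R) (hr : 0 ≤ r) (hrR : r < R)
    (hM : 0 ≤ M) {δ : ℝ} (hδ : 0 < δ) :
    ∃ ε > 0, ∀ (f : ℂ → E) (c : ℂ), DiffContOnCl ℂ f (ball c R) →
      (∀ w ∈ closedBall c R, ‖f w‖ ≤ M) → (∀ w ∈ closedBall c ρ, ‖f w‖ ≤ ε) →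
      ∀ z ∈ closedBall c r, ‖f z‖ < δ := by
  have hR : 0 < R := hρ.trans_le hρR
  have hq0 : 0 ≤ r / R := by positivity
  have hq1 : r / R < 1 := (div_lt_one hR).2 hrR
  have hsum : Summable fun k : ℕ => M * (r / R) ^ k :=
    (summable_geometric_of_lt_one hq0 hq1).mul_left M
  have hmin0 : ∀ {ε : ℝ}, 0 < ε → ∀ k : ℕ, 0 ≤ min (ε * (r / ρ) ^ k) (M * (r / R) ^ k) :=
    fun hε k => le_min (by positivity) (by positivity)
  -- Cauchy's estimates on both radii bound each Taylor term by this minimum. Dominated convergence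
  -- makes the sum small, uniformly in `f` and `c`.
  have hlim : Tendsto (fun ε : ℝ => ∑' k : ℕ, min (ε * (r / ρ) ^ k) (M * (r / R) ^ k))
      (𝓝[>] 0) (𝓝 (∑' _ : ℕ, (0 : ℝ))) := by
    refine tendsto_tsum_of_dominated_convergence hsum (fun k => ?_) ?_
    · have h : Tendsto (fun ε : ℝ => min (ε * (r / ρ) ^ k) (M * (r / R) ^ k)) (𝓝 0)
          (𝓝 (min (0 * (r / ρ) ^ k) (M * (r / R) ^ k))) :=
        (Continuous.tendsto (by fun_prop) 0)
      rw [zero_mul, min_eq_left (by positivity)] at h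
      exact h.mono_left nhdsWithin_le_nhds
    · filter_upwards [self_mem_nhdsWithin] with ε hε k
      rw [Real.norm_of_nonneg (hmin0 hε k)]
      exact min_le_right _ _
  rw [tsum_zero] at hlim
  obtain ⟨ε, hεδ, hε⟩ := ((hlim.eventually (gt_mem_nhds hδ)).and self_mem_nhdsWithin).exists
  refine ⟨ε, hε, fun f c hf hfM hfε z hz => lt_of_le_of_lt ?_ hεδ⟩
  have hzR : z ∈ ball c R := closedBall_subset_ball hrR hz
  have htaylor := Complex.hasSum_taylorSeries_on_ball hf.differentiableOn hzR
  have hle : ∀ k : ℕ, ‖(k.factorial : ℂ)⁻¹ • (z - c) ^ k • iteratedDeriv k f c‖ ≤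
      min (ε * (r / ρ) ^ k) (M * (r / R) ^ k) := fun k =>
    le_min (norm_taylor_term_le hρ (hf.mono (ball_subset_ball hρR)) hfε hz k)
      (norm_taylor_term_le hR hf hfM hz k)
  have hmin : Summable fun k : ℕ => min (ε * (r / ρ) ^ k) (M * (r / R) ^ k) :=
    hsum.of_nonneg_of_le (hmin0 hε) fun k => min_le_right _ _
  rw [← htaylor.tsum_eq]
  exact tsum_of_norm_bounded hmin.hasSum hle

/-! ### Differentiation in `L²` and the integral operator. -/

/-- Differentiability in `L²` from pointwise differentiability and an `L²`-dominated Lipschitz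
bound. -/
theorem hasDerivAt_toLp_of_dominated {X : Type*} [MeasurableSpace X] {μ : Measure X}
    {F : ℂ → Lp ℂ 2 μ} {f : ℂ → X → ℂ} {f' : X → ℂ} {b : X → ℝ} {z₀ : ℂ}
    (hF : ∀ᶠ z in 𝓝 z₀, F z =ᵐ[μ] f z) (hf' : MemLp f' 2 μ) (hb : MemLp b 2 μ)
    (hlip : ∀ᶠ z in 𝓝 z₀, ∀ᵐ x ∂μ, ‖f z x - f z₀ x‖ ≤ b x * ‖z - z₀‖)
    (hderiv : ∀ᵐ x ∂μ, HasDerivAt (fun z => f z x) (f' x) z₀) :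
    HasDerivAt F (hf'.toLp f') z₀ := by
  have hF₀ : F z₀ =ᵐ[μ] f z₀ := hF.self_of_nhds
  rw [hasDerivAt_iff_tendsto_slope]
  refine Lp.tendsto_Lp_of_tendsto_eLpNorm f' hf' ?_
  have hbf : MemLp (fun x => b x + ‖f' x‖) 2 μ := hb.add hf'.norm
  have hslope : ∀ᶠ z in 𝓝[≠] z₀, slope F z₀ z =ᵐ[μ] fun x => slope (fun z => f z x) z₀ z := by
    filter_upwards [nhdsWithin_le_nhds hF] with z hz
    simp only [slope_def_module]
    filter_upwards [hz, hF₀, Lp.coeFn_smul (z - z₀)⁻¹ (F z - F z₀), Lp.coeFn_sub (F z) (F z₀)]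
      with x h1 h2 h3 h4
    rw [h3, Pi.smul_apply, h4, Pi.sub_apply, h1, h2]
  simp_rw [eLpNorm_eq_lintegral_rpow_enorm_toReal two_ne_zero ENNReal.ofNat_ne_top]
  have key : Tendsto (fun z => ∫⁻ x, ‖(slope F z₀ z - f' : X → ℂ) x‖ₑ ^ (ENNReal.toReal 2) ∂μ)
      (𝓝[≠] z₀) (𝓝 (∫⁻ _, 0 ∂μ)) := by
    -- The exceptional null sets depend on `z`; along a sequence there are only countably many.
    refine tendsto_of_seq_tendsto fun u hu => ?_
    obtain ⟨N, hN⟩ := eventually_atTop.1 (hu.eventually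
      (hslope.and ((hlip.filter_mono nhdsWithin_le_nhds).and
        eventually_mem_nhdsWithin)))
    rw [← tendsto_add_atTop_iff_nat N]
    have hN' := fun n => hN (n + N) (Nat.le_add_left N n)
    refine tendsto_lintegral_of_dominated_convergence'
      (fun x => ‖b x + ‖f' x‖‖ₑ ^ (ENNReal.toReal 2)) (fun n => ?_) (fun n => ?_) ?_ ?_
    · exact (((Lp.aestronglyMeasurable _).sub hf'.aestronglyMeasurable).enorm.pow_const _)
    · obtain ⟨h1, h2, h3⟩ := hN' n
      filter_upwards [h1, h2] with x hx1 hx2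
      have hpos : 0 < ‖u (n + N) - z₀‖ := norm_pos_iff.2 (sub_ne_zero.2 h3)
      have h1 : ‖slope (fun z => f z x) z₀ (u (n + N))‖ ≤ b x := by
        rw [slope_def_module, norm_smul, norm_inv, inv_mul_le_iff₀ hpos, mul_comm]
        exact hx2
      rw [Pi.sub_apply, hx1]
      gcongr
      rw [enorm_le_iff_norm_le]
      exact (norm_sub_le _ _).trans ((add_le_add_left h1 _).trans (le_abs_self _))
    · exact (lintegral_rpow_enorm_lt_top_of_eLpNorm_lt_top two_ne_zero ENNReal.ofNat_ne_top
        hbf.eLpNorm_lt_top).ne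
    · filter_upwards [hderiv, ae_all_iff.2 fun n => (hN' n).1] with x hx hx'
      have h := (((hasDerivAt_iff_tendsto_slope.1 hx).sub_const (f' x)).enorm).ennrpow_const
        (ENNReal.toReal 2)
      have h' := h.comp (hu.comp (tendsto_add_atTop_nat N))
      simp only [Pi.sub_apply, hx']
      simpa [Function.comp_def] using h'
  rw [lintegral_zero] at key
  have := key.ennrpow_const (1 / ENNReal.toReal 2)
  simpa using this

/-- For an `L²` kernel, almost every `g ↦ kernelOp s g x` is a bounded functional on `L²`, whose norm
is an `L²` function of `x`; it preserves nonnegativity of imaginary parts if the kernel is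
nonnegative. -/
theorem exists_kernelOp_clm {s : unitInterval × unitInterval → ℝ}
    (hs : MemLp s 2 (volume : Measure (unitInterval × unitInterval)))
    (hs_nonneg : ∀ᵐ p : unitInterval × unitInterval, 0 ≤ s p) :
    ∃ σ : unitInterval → ℝ, MemLp σ 2 volume ∧ ∀ᵐ x : unitInterval,
      ∃ L : Lp ℂ 2 (volume : Measure unitInterval) →L[ℂ] ℂ,
        (∀ g : Lp ℂ 2 (volume : Measure unitInterval), kernelOp s g x = L g) ∧ ‖L‖ ≤ σ x ∧
        ∀ g : Lp ℂ 2 (volume : Measure unitInterval), (∀ᵐ y, 0 ≤ (g y).im) → 0 ≤ (L g).im := by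
  rw [Measure.volume_eq_prod] at hs hs_nonneg
  have hint := hs.integrable_sq
  -- `σ x` is the `L²` norm of the section `s (x, ·)`, which represents the functional as an inner
  -- product.
  refine ⟨fun x => √(∫ y, s (x, y) ^ 2), ?_, ?_⟩
  · have h := hint.integral_prod_left
    rw [memLp_two_iff_integrable_sq (h.aestronglyMeasurable.aemeasurable.sqrt.aestronglyMeasurable)]
    refine h.congr (Eventually.of_forall fun x => ?_)
    exact (Real.sq_sqrt (integral_nonneg fun y => sq_nonneg _)).symm
  · filter_upwards [hint.prod_right_ae, hs.aestronglyMeasurable.prodMk_left,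
      Measure.ae_ae_of_ae_prod hs_nonneg] with x hx1 hx2 hx3
    have hx : MemLp (fun y => (s (x, y) : ℂ)) 2 volume :=
      ((memLp_two_iff_integrable_sq hx2).2 hx1).ofReal
    have hL : ∀ g : Lp ℂ 2 (volume : Measure unitInterval),
        kernelOp s g x = innerSL ℂ (hx.toLp _) g := by
      intro g
      rw [innerSL_apply_apply, L2.inner_def, kernelOp]
      refine integral_congr_ae ?_
      filter_upwards [hx.coeFn_toLp] with y hy
      simp [hy, mul_comm]
    refine ⟨innerSL ℂ (hx.toLp _), hL, ?_, fun g hg => ?_⟩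
    · rw [innerSL_apply_norm]
      refine le_of_eq ?_
      rw [eq_comm, Real.sqrt_eq_iff_mul_self_eq (integral_nonneg fun y => sq_nonneg _)
        (norm_nonneg _), ← @inner_self_eq_norm_mul_norm ℂ, L2.inner_def]
      have : (∫ y, inner ℂ (hx.toLp _ y) (hx.toLp _ y)) = ((∫ y, s (x, y) ^ 2 : ℝ) : ℂ) := by
        rw [← integral_complex_ofReal]
        refine integral_congr_ae ?_
        filter_upwards [hx.coeFn_toLp] with y hy
        simp [hy, ← Complex.ofReal_mul, sq]
      rw [this]
      simp
    · rw [← hL, kernelOp]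
      have hi : Integrable (fun y => (s (x, y) : ℂ) * g y) volume := hx.integrable_mul (Lp.memLp g)
      have := integral_im hi
      simp only [RCLike.im_to_complex] at this
      rw [← this]
      refine integral_nonneg_of_ae ?_
      filter_upwards [hx3, hg] with y h1 h2
      simpa using mul_nonneg h1 h2

theorem aestronglyMeasurable_kernelOp {s : unitInterval × unitInterval → ℝ}
    (hs : MemLp s 2 (volume : Measure (unitInterval × unitInterval)))
    (g : Lp ℂ 2 (volume : Measure unitInterval)) :
    AEStronglyMeasurable (fun x => kernelOp s g x) volume := by
  have h : AEStronglyMeasurable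
      (fun p : unitInterval × unitInterval => (s p : ℂ) * g p.2) (volume.prod volume) :=
    (Complex.continuous_ofReal.comp_aestronglyMeasurable hs.aestronglyMeasurable).mul
      (Lp.aestronglyMeasurable g).comp_snd
  exact h.integral_prod_right'

/-! ### The fixed-point map and its bounds. -/

/-- The functions `g` for which `S g` has nonnegative imaginary part. -/
def dissipativeSet (s : unitInterval × unitInterval → ℝ) :
    Set (Lp ℂ 2 (volume : Measure unitInterval)) :=
  {g | ∀ᵐ x : unitInterval, 0 ≤ (kernelOp s g x).im}

/-- The function `-1 / (z + S g)`. -/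
noncomputable def resolventFun (s : unitInterval × unitInterval → ℝ) (z : ℂ)
    (g : Lp ℂ 2 (volume : Measure unitInterval)) (x : unitInterval) : ℂ :=
  -1 / (z + kernelOp s g x)

open Classical in
/-- The class of `-1 / (z + S g)` in `L²`. -/
noncomputable def resolventMap (s : unitInterval × unitInterval → ℝ) (z : ℂ)
    (g : Lp ℂ 2 (volume : Measure unitInterval)) : Lp ℂ 2 (volume : Measure unitInterval) :=
  -- The default 0 plays no role when `0 < z.im` and `g ∈ dissipativeSet s`, by
  -- `memLp_resolventFun`.
  if h : MemLp (resolventFun s z g) 2 volume then h.toLp _ else 0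

theorem im_neg_one_div_pos {u : ℂ} (hu : 0 < u.im) : 0 < (-1 / u).im := by
  have hu0 : u ≠ 0 := fun h => by simp [h] at hu
  have : 0 < Complex.normSq u := Complex.normSq_pos.2 hu0
  rw [neg_div, one_div, Complex.neg_im, Complex.inv_im]
  have := div_pos hu this
  rw [neg_div]
  linarith

theorem norm_neg_one_div_le {u : ℂ} {η : ℝ} (hη : 0 < η) (hu : η ≤ u.im) : ‖-1 / u‖ ≤ 1 / η := by
  rw [norm_div, norm_neg, norm_one]
  exact one_div_le_one_div_of_le hη (hu.trans ((le_abs_self _).trans (Complex.abs_im_le_norm u)))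

theorem norm_neg_one_div_sub_le {u v : ℂ} {η θ : ℝ} (hη : 0 < η) (hθ : 0 < θ) (hu : η ≤ u.im)
    (hv : θ ≤ v.im) : ‖-1 / u - -1 / v‖ ≤ ‖u - v‖ / (η * θ) := by
  have hu' : η ≤ ‖u‖ := hu.trans ((le_abs_self _).trans (Complex.abs_im_le_norm u))
  have hv' : θ ≤ ‖v‖ := hv.trans ((le_abs_self _).trans (Complex.abs_im_le_norm v))
  have hu0 : u ≠ 0 := norm_pos_iff.1 (hη.trans_le hu')
  have hv0 : v ≠ 0 := norm_pos_iff.1 (hθ.trans_le hv')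
  have : -1 / u - -1 / v = (u - v) / (u * v) := by field_simp; ring
  rw [this, norm_div, norm_mul]
  gcongr

section QVE

variable {s : unitInterval × unitInterval → ℝ}

theorem memLp_resolventFun
    (hs : MemLp s 2 (volume : Measure (unitInterval × unitInterval)))
    {z : ℂ} (hz : 0 < z.im) {g : Lp ℂ 2 (volume : Measure unitInterval)}
    (hg : g ∈ dissipativeSet s) : MemLp (resolventFun s z g) 2 volume := by
  refine MemLp.of_bound ?_ (1 / z.im) ?_
  · exact ((aestronglyMeasurable_kernelOp hs g).aemeasurable.const_add z).const_div (-1)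
      |>.aestronglyMeasurable
  · filter_upwards [hg] with x hx
    exact norm_neg_one_div_le hz (by simpa using hx)

theorem coeFn_resolventMap
    (hs : MemLp s 2 (volume : Measure (unitInterval × unitInterval)))
    {z : ℂ} (hz : 0 < z.im) {g : Lp ℂ 2 (volume : Measure unitInterval)}
    (hg : g ∈ dissipativeSet s) : resolventMap s z g =ᵐ[volume] resolventFun s z g := by
  rw [resolventMap, dif_pos (memLp_resolventFun hs hz hg)]
  exact MemLp.coeFn_toLp _

theorem im_resolventMap_pos
    (hs : MemLp s 2 (volume : Measure (unitInterval × unitInterval)))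
    {z : ℂ} (hz : 0 < z.im) {g : Lp ℂ 2 (volume : Measure unitInterval)}
    (hg : g ∈ dissipativeSet s) : ∀ᵐ x, 0 < (resolventMap s z g x).im := by
  filter_upwards [coeFn_resolventMap hs hz hg, hg] with x h1 h2
  rw [h1]
  exact im_neg_one_div_pos (by simpa using add_pos_of_pos_of_nonneg hz h2)

theorem norm_resolventMap_le
    (hs : MemLp s 2 (volume : Measure (unitInterval × unitInterval)))
    {z : ℂ} (hz : 0 < z.im) {g : Lp ℂ 2 (volume : Measure unitInterval)}
    (hg : g ∈ dissipativeSet s) : ‖resolventMap s z g‖ ≤ 1 / z.im := by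
  have h : ∀ᵐ x, ‖resolventMap s z g x‖ ≤ 1 / z.im := by
    filter_upwards [coeFn_resolventMap hs hz hg, hg] with x h1 h2
    rw [h1]
    exact norm_neg_one_div_le hz (by simpa using h2)
  simpa [measureUnivNNReal] using Lp.norm_le_of_ae_bound (by positivity) h

theorem mem_dissipativeSet_of_im_nonneg
    (hs : MemLp s 2 (volume : Measure (unitInterval × unitInterval)))
    (hs_nonneg : ∀ᵐ p : unitInterval × unitInterval, 0 ≤ s p)
    {g : Lp ℂ 2 (volume : Measure unitInterval)} (hg : ∀ᵐ x, 0 ≤ (g x).im) :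
    g ∈ dissipativeSet s := by
  obtain ⟨σ, -, hL⟩ := exists_kernelOp_clm hs hs_nonneg
  filter_upwards [hL] with x ⟨L, hL, _, hpos⟩
  rw [hL]
  exact hpos g hg

theorem resolventMap_mem
    (hs : MemLp s 2 (volume : Measure (unitInterval × unitInterval)))
    (hs_nonneg : ∀ᵐ p : unitInterval × unitInterval, 0 ≤ s p)
    {z : ℂ} (hz : 0 < z.im) {g : Lp ℂ 2 (volume : Measure unitInterval)}
    (hg : g ∈ dissipativeSet s) : resolventMap s z g ∈ dissipativeSet s :=
  mem_dissipativeSet_of_im_nonneg hs hs_nonneg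
    ((im_resolventMap_pos hs hz hg).mono fun _ h => h.le)

theorem zero_mem_dissipativeSet
    (hs : MemLp s 2 (volume : Measure (unitInterval × unitInterval)))
    (hs_nonneg : ∀ᵐ p : unitInterval × unitInterval, 0 ≤ s p) : 0 ∈ dissipativeSet s := by
  exact mem_dissipativeSet_of_im_nonneg hs hs_nonneg (Eventually.of_forall fun x => by simp)

theorem isClosed_dissipativeSet
    (hs : MemLp s 2 (volume : Measure (unitInterval × unitInterval)))
    (hs_nonneg : ∀ᵐ p : unitInterval × unitInterval, 0 ≤ s p) : IsClosed (dissipativeSet s) := by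
  obtain ⟨σ, -, hL⟩ := exists_kernelOp_clm hs hs_nonneg
  refine isClosed_of_closure_subset fun g hg => ?_
  obtain ⟨u, hu, hlim⟩ := mem_closure_iff_seq_limit.1 hg
  filter_upwards [hL, ae_all_iff.2 hu] with x ⟨L, hL, _, _⟩ hx
  rw [hL]
  refine ge_of_tendsto' ((Complex.continuous_im.comp L.continuous).tendsto g |>.comp hlim)
    fun n => ?_
  simpa [hL] using hx n

theorem isQVESolution_iff
    (hs : MemLp s 2 (volume : Measure (unitInterval × unitInterval)))
    (hs_nonneg : ∀ᵐ p : unitInterval × unitInterval, 0 ≤ s p)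
    {z : ℂ} (hz : 0 < z.im) {g : Lp ℂ 2 (volume : Measure unitInterval)} :
    IsQVESolution s z g ↔ g ∈ dissipativeSet s ∧ resolventMap s z g = g := by
  constructor
  · intro h
    have hg := mem_dissipativeSet_of_im_nonneg hs hs_nonneg (h.im_pos.mono fun _ h => h.le)
    refine ⟨hg, Lp.ext ?_⟩
    filter_upwards [coeFn_resolventMap hs hz hg, h.eqn] with x h1 h2
    rw [h1, h2, resolventFun]
  · rintro ⟨hg, h⟩
    have h1 := im_resolventMap_pos hs hz hg
    have h2 := coeFn_resolventMap hs hz hg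
    rw [h] at h1 h2
    exact ⟨h1, h2⟩

/-- Both denominators have modulus at least `z.im`, so the pointwise difference is at most `σ x * ‖g
- h‖ / z.im ^ 2`; thus `C` is the `L²` norm of `σ`. -/
theorem exists_norm_resolventMap_sub_le
    (hs : MemLp s 2 (volume : Measure (unitInterval × unitInterval)))
    (hs_nonneg : ∀ᵐ p : unitInterval × unitInterval, 0 ≤ s p) :
    ∃ C : ℝ, 0 ≤ C ∧ ∀ z : ℂ, 0 < z.im → ∀ g ∈ dissipativeSet s, ∀ h ∈ dissipativeSet s,
      ‖resolventMap s z g - resolventMap s z h‖ ≤ C / z.im ^ 2 * ‖g - h‖ := by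
  obtain ⟨σ, hσ, hL⟩ := exists_kernelOp_clm hs hs_nonneg
  refine ⟨‖hσ.toLp σ‖, norm_nonneg _, fun z hz g hg h hh => ?_⟩
  have key : ∀ᵐ x, ‖(resolventMap s z g - resolventMap s z h) x‖ ≤
      ‖g - h‖ / z.im ^ 2 * ‖hσ.toLp σ x‖ := by
    filter_upwards [hL, hg, hh, coeFn_resolventMap hs hz hg, coeFn_resolventMap hs hz hh,
      Lp.coeFn_sub (resolventMap s z g) (resolventMap s z h), hσ.coeFn_toLp]
      with x ⟨L, hL, hLσ, _⟩ h1 h2 h3 h4 h5 h6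
    rw [h5, Pi.sub_apply, h3, h4, h6]
    refine (norm_neg_one_div_sub_le hz hz (by simpa using h1) (by simpa using h2)).trans ?_
    have : ‖L (g - h)‖ ≤ ‖σ x‖ * ‖g - h‖ :=
      L.le_of_opNorm_le (hLσ.trans (le_abs_self _)) _
    rw [add_sub_add_left_eq_sub, hL, hL, ← map_sub, ← sq, div_mul_eq_mul_div, mul_comm ‖g - h‖]
    gcongr
  exact (Lp.norm_le_mul_norm_of_ae_le_mul key).trans_eq (by ring)

/-! ### Holomorphic dependence on `z`. -/

theorem memLp_one_add_mul_div {σ : unitInterval → ℝ} (hσ : MemLp σ 2 volume) (a b : ℝ) :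
    MemLp (fun x => (1 + σ x * a) / b) 2 (volume : Measure unitInterval) := by
  have h1 : MemLp (fun _ : unitInterval => (1 : ℝ)) 2 volume := memLp_const 1
  have h2 : MemLp (fun x => a * σ x) 2 (volume : Measure unitInterval) := hσ.const_mul a
  have h3 : MemLp (fun x => b⁻¹ * (1 + a * σ x)) 2 (volume : Measure unitInterval) :=
    (h1.add h2).const_mul b⁻¹
  refine h3.ae_eq (Eventually.of_forall fun x => ?_)
  show b⁻¹ * (1 + a * σ x) = (1 + σ x * a) / b
  ring

theorem memLp_deriv_resolventFun
    (hs : MemLp s 2 (volume : Measure (unitInterval × unitInterval)))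
    (hs_nonneg : ∀ᵐ p : unitInterval × unitInterval, 0 ≤ s p)
    {z : ℂ} (hz : 0 < z.im) {g : Lp ℂ 2 (volume : Measure unitInterval)}
    (hg : g ∈ dissipativeSet s) (h : Lp ℂ 2 (volume : Measure unitInterval)) :
    MemLp (fun x => (1 + kernelOp s h x) / (z + kernelOp s g x) ^ 2) 2
      (volume : Measure unitInterval) := by
  obtain ⟨σ, hσ, hL⟩ := exists_kernelOp_clm hs hs_nonneg
  have hb : MemLp (fun x => (1 + σ x * ‖h‖) / z.im ^ 2) 2
      (volume : Measure unitInterval) := by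
    exact memLp_one_add_mul_div hσ _ _
  refine hb.mono ?_ ?_
  · have h1 := (aestronglyMeasurable_kernelOp hs h).aemeasurable
    have h2 := (aestronglyMeasurable_kernelOp hs g).aemeasurable
    exact AEMeasurable.aestronglyMeasurable (by fun_prop)
  · filter_upwards [hL, hg] with x ⟨L, hL, hLσ, _⟩ hx
    refine le_trans ?_ (le_abs_self _)
    have h1 : ‖1 + kernelOp s h x‖ ≤ 1 + σ x * ‖h‖ := by
      refine (norm_add_le _ _).trans ?_
      rw [norm_one, hL]
      gcongr
      exact L.le_of_opNorm_le hLσ _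
    have h2 : z.im ≤ ‖z + kernelOp s g x‖ :=
      le_trans (by simpa using hx) ((le_abs_self _).trans (Complex.abs_im_le_norm _))
    rw [norm_div, norm_pow]
    have := (norm_nonneg _).trans h1
    gcongr

/-- Stated along a curve `G`, since `dissipativeSet s` need not be a neighbourhood of its points.
The chain rule applies for almost every `x`, and `σ` supplies the `L²` domination. -/
theorem differentiableAt_resolventMap
    (hs : MemLp s 2 (volume : Measure (unitInterval × unitInterval)))
    (hs_nonneg : ∀ᵐ p : unitInterval × unitInterval, 0 ≤ s p)
    {G : ℂ → Lp ℂ 2 (volume : Measure unitInterval)} {z₀ : ℂ} (hz₀ : 0 < z₀.im)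
    (hG : ∀ z : ℂ, 0 < z.im → G z ∈ dissipativeSet s) (hd : DifferentiableAt ℂ G z₀) :
    DifferentiableAt ℂ (fun z => resolventMap s z (G z)) z₀ := by
  obtain ⟨σ, hσ, hL⟩ := exists_kernelOp_clm hs hs_nonneg
  obtain ⟨C, hC⟩ := hd.isBigO_sub.bound
  obtain ⟨G', hG'⟩ : ∃ G', HasDerivAt G G' z₀ := ⟨_, hd.hasDerivAt⟩
  have him : ∀ᶠ z : ℂ in 𝓝 z₀, z₀.im / 2 < z.im :=
    Complex.continuous_im.continuousAt.eventually (lt_mem_nhds (half_lt_self hz₀))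
  have hη : 0 < z₀.im / 2 := half_pos hz₀
  have hf' := memLp_deriv_resolventFun hs hs_nonneg hz₀ (hG z₀ hz₀) G'
  have hb : MemLp (fun x => (1 + σ x * C) / (z₀.im / 2 * z₀.im)) 2
      (volume : Measure unitInterval) := by
    exact memLp_one_add_mul_div hσ _ _
  refine (hasDerivAt_toLp_of_dominated (f := fun z => resolventFun s z (G z)) ?_ hf' hb ?_
    ?_).differentiableAt
  · filter_upwards [him] with z hz
    exact coeFn_resolventMap hs (hη.trans hz) (hG z (hη.trans hz))
  · filter_upwards [him, hC] with z hz hCz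
    filter_upwards [hL, hG z (hη.trans hz), hG z₀ hz₀] with x ⟨L, hL, hLσ, _⟩ h1 h2
    refine (norm_neg_one_div_sub_le hη hz₀ (u := z + kernelOp s (G z) x)
      (v := z₀ + kernelOp s (G z₀) x) ?_ (by simpa using h2)).trans ?_
    · rw [Complex.add_im]
      linarith
    · rw [div_mul_eq_mul_div (1 + σ x * C)]
      gcongr
      have hσx : 0 ≤ σ x := (norm_nonneg _).trans hLσ
      calc ‖z + kernelOp s (G z) x - (z₀ + kernelOp s (G z₀) x)‖
          = ‖(z - z₀) + L (G z - G z₀)‖ := by rw [hL, hL, map_sub]; congr 1; ring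
        _ ≤ ‖z - z₀‖ + σ x * (C * ‖z - z₀‖) := by
          refine (norm_add_le _ _).trans ?_
          gcongr
          exact (L.le_of_opNorm_le hLσ _).trans (by gcongr)
        _ = (1 + σ x * C) * ‖z - z₀‖ := by ring
  · filter_upwards [hL, hG z₀ hz₀] with x ⟨L, hL, _, _⟩ hx
    have hne : z₀ + L (G z₀) ≠ 0 := fun h => by
      have := congrArg Complex.im h
      rw [← hL, Complex.add_im, Complex.zero_im] at this
      linarith
    simp only [resolventFun, hL]
    have h1 : HasDerivAt (fun z => z + L (G z)) (1 + L G') z₀ :=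
      (hasDerivAt_id z₀).add (L.hasFDerivAt.comp_hasDerivAt z₀ hG')
    have h2 : HasDerivAt (fun z => -1 / (z + L (G z))) _ z₀ :=
      (hasDerivAt_const z₀ (-1 : ℂ)).div h1 hne
    exact h2.congr_deriv (by ring)

/-! ### Iterates and their convergence. -/

theorem iterate_resolventMap_mem
    (hs : MemLp s 2 (volume : Measure (unitInterval × unitInterval)))
    (hs_nonneg : ∀ᵐ p : unitInterval × unitInterval, 0 ≤ s p)
    {z : ℂ} (hz : 0 < z.im) {g : Lp ℂ 2 (volume : Measure unitInterval)}
    (hg : g ∈ dissipativeSet s) (n : ℕ) : (resolventMap s z)^[n] g ∈ dissipativeSet s := by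
  induction n with
  | zero => exact hg
  | succ n ih =>
    rw [Function.iterate_succ_apply']
    exact resolventMap_mem hs hs_nonneg hz ih

theorem norm_iterate_succ_resolventMap_le
    (hs : MemLp s 2 (volume : Measure (unitInterval × unitInterval)))
    (hs_nonneg : ∀ᵐ p : unitInterval × unitInterval, 0 ≤ s p)
    {z : ℂ} (hz : 0 < z.im) {g : Lp ℂ 2 (volume : Measure unitInterval)}
    (hg : g ∈ dissipativeSet s) (n : ℕ) : ‖(resolventMap s z)^[n + 1] g‖ ≤ 1 / z.im := by
  rw [Function.iterate_succ_apply']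
  exact norm_resolventMap_le hs hz (iterate_resolventMap_mem hs hs_nonneg hz hg n)

theorem norm_iterate_resolventMap_zero_le
    (hs : MemLp s 2 (volume : Measure (unitInterval × unitInterval)))
    (hs_nonneg : ∀ᵐ p : unitInterval × unitInterval, 0 ≤ s p)
    {z : ℂ} (hz : 0 < z.im) (n : ℕ) : ‖(resolventMap s z)^[n] 0‖ ≤ 1 / z.im := by
  cases n with
  | zero => simpa using hz.le
  | succ n =>
    exact norm_iterate_succ_resolventMap_le hs hs_nonneg hz (zero_mem_dissipativeSet hs hs_nonneg) n

theorem differentiableAt_iterate_resolventMap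
    (hs : MemLp s 2 (volume : Measure (unitInterval × unitInterval)))
    (hs_nonneg : ∀ᵐ p : unitInterval × unitInterval, 0 ≤ s p)
    {z : ℂ} (hz : 0 < z.im) {g : Lp ℂ 2 (volume : Measure unitInterval)}
    (hg : g ∈ dissipativeSet s) (n : ℕ) :
    DifferentiableAt ℂ (fun z => (resolventMap s z)^[n] g) z := by
  induction n with
  | zero => exact differentiableAt_const g
  | succ n ih =>
    simp_rw [Function.iterate_succ_apply']
    exact differentiableAt_resolventMap hs hs_nonneg hz
      (fun w hw => iterate_resolventMap_mem hs hs_nonneg hw hg n) ih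

/-- Far from the real axis, iteration of `g ↦ -1 / (z + S g)` contracts. -/
theorem exists_norm_iterate_sub_le
    (hs : MemLp s 2 (volume : Measure (unitInterval × unitInterval)))
    (hs_nonneg : ∀ᵐ p : unitInterval × unitInterval, 0 ≤ s p) :
    ∃ θ : ℝ, 0 < θ ∧ ∀ z : ℂ, θ ≤ z.im → ∀ g ∈ dissipativeSet s, ∀ h ∈ dissipativeSet s, ∀ n : ℕ,
      ‖(resolventMap s z)^[n] g - (resolventMap s z)^[n] h‖ ≤ (1 / 2) ^ n * ‖g - h‖ := by
  obtain ⟨C, hC0, hC⟩ := exists_norm_resolventMap_sub_le hs hs_nonneg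
  -- With `z.im ≥ 2 * C + 1`, the Lipschitz constant `C / z.im ^ 2` is at most 1/2.
  refine ⟨2 * C + 1, by positivity, fun z hz g hg h hh n => ?_⟩
  have hz0 : 0 < z.im := by linarith
  have hq : C / z.im ^ 2 ≤ 1 / 2 := by
    rw [div_le_div_iff₀ (by positivity) two_pos]
    nlinarith
  induction n with
  | zero => simp
  | succ n ih =>
    rw [Function.iterate_succ_apply', Function.iterate_succ_apply', pow_succ', mul_assoc]
    refine (hC z hz0 _ (iterate_resolventMap_mem hs hs_nonneg hz0 hg n) _
      (iterate_resolventMap_mem hs hs_nonneg hz0 hh n)).trans ?_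
    gcongr

theorem le_im_of_mem_closedBall {c w : ℂ} {R : ℝ} (hw : w ∈ closedBall c R) : c.im - R ≤ w.im := by
  have h : ‖w - c‖ ≤ R := by simpa [dist_eq_norm] using hw
  have := (neg_le_abs _).trans ((Complex.abs_im_le_norm (w - c)).trans h)
  rw [Complex.sub_im] at this
  linarith

/-- Every point of the upper half-plane lies in a disc inside the half-plane whose centre is far
from the real axis. -/
theorem exists_disc_upperHalfPlane {z₀ : ℂ} (hz₀ : 0 < z₀.im) (θ : ℝ) :
    ∃ (c : ℂ) (r R ρ η : ℝ), 0 < ρ ∧ ρ ≤ R ∧ 0 ≤ r ∧ r < R ∧ 0 < η ∧ z₀ ∈ ball c r ∧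
      (∀ w ∈ closedBall c R, η ≤ w.im) ∧ ∀ w ∈ closedBall c ρ, θ ≤ w.im := by
  set b := z₀.im with hb
  -- The disc has centre `T * I` and radius `T - b / 2`, so it stays above height `b / 2`. It
  -- contains `z₀` once `‖z₀‖ ^ 2 < T * b + b ^ 2 / 4`; the term `2 * |θ|` keeps the subdisc of
  -- radius `T / 2` above `θ`.
  set T := ‖z₀‖ ^ 2 / b + b + 2 * |θ| with hT
  have hTb : ‖z₀‖ ^ 2 + b ^ 2 ≤ T * b := by
    have : T * b = ‖z₀‖ ^ 2 + b ^ 2 + 2 * |θ| * b := by rw [hT]; field_simp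
    rw [this]
    have := mul_nonneg (abs_nonneg θ) hz₀.le
    linarith
  have hbT : b ≤ T := by
    have : 0 ≤ ‖z₀‖ ^ 2 / b := by positivity
    linarith [abs_nonneg θ]
  have hθT : θ ≤ T / 2 := by
    have : 0 ≤ ‖z₀‖ ^ 2 / b := by positivity
    linarith [le_abs_self θ]
  have hdist : ‖z₀ - T * Complex.I‖ < T - b / 2 := by
    refine lt_of_pow_lt_pow_left₀ 2 (by linarith) ?_
    have h1 : ‖z₀‖ ^ 2 = z₀.re ^ 2 + b ^ 2 := by
      rw [← Complex.normSq_eq_norm_sq, Complex.normSq_apply]; ring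
    have h2 : ‖z₀ - T * Complex.I‖ ^ 2 = z₀.re ^ 2 + (b - T) ^ 2 := by
      rw [← Complex.normSq_eq_norm_sq, Complex.normSq_apply]
      simp only [Complex.sub_re, Complex.sub_im, Complex.mul_re, Complex.mul_im, Complex.ofReal_re,
        Complex.ofReal_im, Complex.I_re, Complex.I_im]
      ring
    rw [h2]
    nlinarith
  refine ⟨T * Complex.I, (‖z₀ - T * Complex.I‖ + (T - b / 2)) / 2, T - b / 2, T / 2, b / 2,
    by linarith, by linarith, by linarith [norm_nonneg (z₀ - T * Complex.I)], by linarith,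
    by linarith, ?_, fun w hw => ?_, fun w hw => ?_⟩
  · rw [mem_ball, dist_eq_norm]
    linarith
  · have := le_im_of_mem_closedBall hw
    simp at this
    linarith
  · have := le_im_of_mem_closedBall hw
    simp at this
    linarith

theorem exists_uniformCauchySeqOn_iterate
    (hs : MemLp s 2 (volume : Measure (unitInterval × unitInterval)))
    (hs_nonneg : ∀ᵐ p : unitInterval × unitInterval, 0 ≤ s p) {z₀ : ℂ} (hz₀ : 0 < z₀.im) :
    ∃ (c : ℂ) (r : ℝ), z₀ ∈ ball c r ∧ (∀ z ∈ ball c r, 0 < z.im) ∧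
      UniformCauchySeqOn (fun n z => (resolventMap s z)^[n] 0) atTop (ball c r) := by
  obtain ⟨θ, hθ, hcontr⟩ := exists_norm_iterate_sub_le hs hs_nonneg
  obtain ⟨c, r, R, ρ, η, hρ, hρR, hr, hrR, hη, hz₀r, hR, hρθ⟩ := exists_disc_upperHalfPlane hz₀ θ
  have h0 := zero_mem_dissipativeSet hs hs_nonneg
  refine ⟨c, r, hz₀r, fun z hz =>
    hη.trans_le (hR z (ball_subset_closedBall (ball_subset_ball hrR.le hz))),
    Metric.uniformCauchySeqOn_iff.2 fun δ hδ => ?_⟩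
  obtain ⟨ε, hε, hsmall⟩ := exists_small_of_small_on_subdisc
    (E := Lp ℂ 2 (volume : Measure unitInterval)) hρ hρR hr hrR
    (M := 1 / η + 1 / η) (by positivity) hδ
  obtain ⟨N, hN⟩ := (((tendsto_pow_atTop_nhds_zero_of_lt_one (r := (1 / 2 : ℝ)) (by norm_num)
    (by norm_num)).mul_const (1 / θ + 1 / θ)).eventually
      (gt_mem_nhds (by simpa using hε))).exists
  refine ⟨N, fun m hm n hn z hz => ?_⟩
  rw [dist_eq_norm]
  refine hsmall (fun z => (resolventMap s z)^[m] 0 - (resolventMap s z)^[n] 0) c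
    (DifferentiableOn.diffContOnCl_ball (U := {z : ℂ | 0 < z.im}) ?_
      fun w hw => hη.trans_le (hR w hw)) (fun w hw => ?_) (fun w hw => ?_) z
    (ball_subset_closedBall hz)
  · exact fun w hw => ((differentiableAt_iterate_resolventMap hs hs_nonneg hw h0 m).sub
      (differentiableAt_iterate_resolventMap hs hs_nonneg hw h0 n)).differentiableWithinAt
  · have hw0 : 0 < w.im := hη.trans_le (hR w hw)
    have hwη : 1 / w.im ≤ 1 / η := one_div_le_one_div_of_le hη (hR w hw)
    exact (norm_sub_le _ _).trans (add_le_add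
      ((norm_iterate_resolventMap_zero_le hs hs_nonneg hw0 m).trans hwη)
      ((norm_iterate_resolventMap_zero_le hs hs_nonneg hw0 n).trans hwη))
  · have hw0 : 0 < w.im := hθ.trans_le (hρθ w hw)
    have hwθ : 1 / w.im ≤ 1 / θ := one_div_le_one_div_of_le hθ (hρθ w hw)
    -- Both iterates are `N` contracting steps applied to points of norm at most `1 / θ`.
    obtain ⟨k, rfl⟩ := Nat.exists_eq_add_of_le hm
    obtain ⟨l, rfl⟩ := Nat.exists_eq_add_of_le hn
    rw [Function.iterate_add_apply, Function.iterate_add_apply]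
    refine (hcontr w (hρθ w hw) _ (iterate_resolventMap_mem hs hs_nonneg hw0 h0 k) _
      (iterate_resolventMap_mem hs hs_nonneg hw0 h0 l) N).trans (le_trans ?_ hN.le)
    gcongr
    exact (norm_sub_le _ _).trans (add_le_add
      ((norm_iterate_resolventMap_zero_le hs hs_nonneg hw0 k).trans hwθ)
      ((norm_iterate_resolventMap_zero_le hs hs_nonneg hw0 l).trans hwθ))

/-- The dependence of the iterates on the starting point disappears in the limit. -/
theorem tendsto_iterate_sub_iterate_zero
    (hs : MemLp s 2 (volume : Measure (unitInterval × unitInterval)))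
    (hs_nonneg : ∀ᵐ p : unitInterval × unitInterval, 0 ≤ s p) {z₀ : ℂ} (hz₀ : 0 < z₀.im)
    {g : Lp ℂ 2 (volume : Measure unitInterval)} (hg : g ∈ dissipativeSet s) :
    Tendsto (fun n => (resolventMap s z₀)^[n] g - (resolventMap s z₀)^[n] 0) atTop (𝓝 0) := by
  obtain ⟨θ, hθ, hcontr⟩ := exists_norm_iterate_sub_le hs hs_nonneg
  obtain ⟨c, r, R, ρ, η, hρ, hρR, hr, hrR, hη, hz₀r, hR, hρθ⟩ := exists_disc_upperHalfPlane hz₀ θ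
  have h0 := zero_mem_dissipativeSet hs hs_nonneg
  refine NormedAddGroup.tendsto_nhds_zero.2 fun δ hδ => ?_
  obtain ⟨ε, hε, hsmall⟩ := exists_small_of_small_on_subdisc
    (E := Lp ℂ 2 (volume : Measure unitInterval)) hρ hρR hr hrR
    (M := 1 / η + 1 / η) (by positivity) hδ
  filter_upwards [((tendsto_pow_atTop_nhds_zero_of_lt_one (r := (1 / 2 : ℝ)) (by norm_num)
    (by norm_num)).mul_const ‖g - 0‖).eventually (gt_mem_nhds (by simpa using hε)),
    eventually_ge_atTop 1] with n hn hn1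
  -- At least one step is needed: `g` itself need not obey the bound `1 / η`.
  obtain ⟨k, rfl⟩ := Nat.exists_eq_add_of_le' hn1
  refine hsmall (fun z => (resolventMap s z)^[k + 1] g - (resolventMap s z)^[k + 1] 0) c
    (DifferentiableOn.diffContOnCl_ball (U := {z : ℂ | 0 < z.im}) ?_
      fun w hw => hη.trans_le (hR w hw)) (fun w hw => ?_) (fun w hw => ?_) z₀
    (ball_subset_closedBall hz₀r)
  · exact fun w hw => ((differentiableAt_iterate_resolventMap hs hs_nonneg hw hg _).sub
      (differentiableAt_iterate_resolventMap hs hs_nonneg hw h0 _)).differentiableWithinAt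
  · have hw0 : 0 < w.im := hη.trans_le (hR w hw)
    have hwη : 1 / w.im ≤ 1 / η := one_div_le_one_div_of_le hη (hR w hw)
    exact (norm_sub_le _ _).trans (add_le_add
      ((norm_iterate_succ_resolventMap_le hs hs_nonneg hw0 hg k).trans hwη)
      ((norm_iterate_succ_resolventMap_le hs hs_nonneg hw0 h0 k).trans hwη))
  · exact (hcontr w (hρθ w hw) g hg 0 h0 (k + 1)).trans hn.le

/-! ### Existence, uniqueness and holomorphy of the solution. -/

/-- Iteration started at a solution is constant, so every solution is the limit of one and the same
sequence. -/
theorem tendsto_iterate_zero_of_isQVESolution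
    (hs : MemLp s 2 (volume : Measure (unitInterval × unitInterval)))
    (hs_nonneg : ∀ᵐ p : unitInterval × unitInterval, 0 ≤ s p) {z : ℂ} (hz : 0 < z.im)
    {g : Lp ℂ 2 (volume : Measure unitInterval)} (hg : IsQVESolution s z g) :
    Tendsto (fun n => (resolventMap s z)^[n] 0) atTop (𝓝 g) := by
  obtain ⟨hgm, hfix⟩ := (isQVESolution_iff hs hs_nonneg hz).1 hg
  have h := tendsto_iterate_sub_iterate_zero hs hs_nonneg hz hgm
  simp_rw [Function.iterate_fixed hfix] at h
  simpa using h.const_sub g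

theorem exists_isQVESolution
    (hs : MemLp s 2 (volume : Measure (unitInterval × unitInterval)))
    (hs_nonneg : ∀ᵐ p : unitInterval × unitInterval, 0 ≤ s p) {z : ℂ} (hz : 0 < z.im) :
    ∃ g : Lp ℂ 2 (volume : Measure unitInterval), IsQVESolution s z g := by
  obtain ⟨c, r, hzr, -, hcauchy⟩ := exists_uniformCauchySeqOn_iterate hs hs_nonneg hz
  obtain ⟨g, hg⟩ := cauchySeq_tendsto_of_complete (hcauchy.cauchySeq hzr)
  have hmem := iterate_resolventMap_mem hs hs_nonneg hz (zero_mem_dissipativeSet hs hs_nonneg)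
  have hgm : g ∈ dissipativeSet s :=
    (isClosed_dissipativeSet hs hs_nonneg).mem_of_tendsto hg (Eventually.of_forall hmem)
  refine ⟨g, (isQVESolution_iff hs hs_nonneg hz).2 ⟨hgm, ?_⟩⟩
  obtain ⟨C, -, hC⟩ := exists_norm_resolventMap_sub_le hs hs_nonneg
  have hlim : Tendsto (fun n => resolventMap s z ((resolventMap s z)^[n] 0)) atTop
      (𝓝 (resolventMap s z g)) := by
    rw [tendsto_iff_norm_sub_tendsto_zero] at hg ⊢
    refine squeeze_zero (fun n => norm_nonneg _) (fun n => hC z hz _ (hmem n) g hgm) ?_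
    simpa using hg.const_mul (C / z.im ^ 2)
  have hsucc := hg.comp (tendsto_add_atTop_nat 1)
  simp only [Function.comp_def, Function.iterate_succ_apply'] at hsucc
  exact tendsto_nhds_unique hlim hsucc

end QVE

theorem theoremA1 (s : unitInterval × unitInterval → ℝ)
    (hs : MemLp s 2 (volume : Measure (unitInterval × unitInterval)))
    (hs_nonneg : ∀ᵐ p : unitInterval × unitInterval, 0 ≤ s p) :
    (∀ z : ℂ, 0 < z.im →
      ∃! g : Lp ℂ 2 (volume : Measure unitInterval), IsQVESolution s z g) ∧
    (∀ g : ℂ → Lp ℂ 2 (volume : Measure unitInterval),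
      (∀ z : ℂ, 0 < z.im → IsQVESolution s z (g z)) →
      DifferentiableOn ℂ g {z : ℂ | 0 < z.im}) := by
  refine ⟨fun z hz => ?_, fun g hg z hz => ?_⟩
  · obtain ⟨g, hg⟩ := exists_isQVESolution hs hs_nonneg hz
    exact ⟨g, hg, fun h hh => tendsto_nhds_unique
      (tendsto_iterate_zero_of_isQVESolution hs hs_nonneg hz hh)
      (tendsto_iterate_zero_of_isQVESolution hs hs_nonneg hz hg)⟩
  · obtain ⟨c, r, hzr, him, hcauchy⟩ := exists_uniformCauchySeqOn_iterate hs hs_nonneg hz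
    have hunif := hcauchy.tendstoUniformlyOn_of_tendsto fun w hw =>
      tendsto_iterate_zero_of_isQVESolution hs hs_nonneg (him w hw) (hg w (him w hw))
    have hdiff : DifferentiableOn ℂ g (ball c r) :=
      hunif.tendstoLocallyUniformlyOn.differentiableOn (Eventually.of_forall fun n w hw =>
        (differentiableAt_iterate_resolventMap hs hs_nonneg (him w hw)
          (zero_mem_dissipativeSet hs hs_nonneg) n).differentiableWithinAt) isOpen_ball
    exact (hdiff.differentiableAt (isOpen_ball.mem_nhds hzr)).differentiableWithinAt
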